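/- A set of $N$ positive integers is called a $D(-1)$-$N$-set if the product of any two distinct elements, decreased by $1$, is a perfect square; a $D(-1)$-quadruple is such a set with $N=4$. Let $\{1,b,c,d\}$ with $1<b<c<d$ be a $D(-1)$-quadruple, and let $r,s,t,z$ be the positive integers with $$b-1=r^2,\quad c-1=s^2,\quad bc-1=t^2,\quad cd-1=z^2 .$$ For $\rho\in\{-1,1\}$ and integers $p\ge 0$ put $$v_p=\frac s2\Big((s+\sqrt c)^{2p}+(s-\sqrt c)^{2p}\Big),$$ $$w_p=\frac{s\sqrt b+\rho r\sqrt c}{2\sqrt b}\,(t+\sqrt{bc})^{2p}+\frac{s\sqrt b-\rho r\sqrt c}{2\sqrt b}\,(t-\sqrt{bc})^{2p}.$$ Let $\rho\in\{-1,1\}$ and let $m,n\ge 0$ be integers such that $z=v_m=w_n$. Then: 1. if $c>b^3$, then $n>\min\{\,b,\;0.125\sqrt{c/b}\,\}$; 2. if $4b^2<c<b^3$, then $n>0.125\,c/b^2$. -/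

import Mathlib

/-- `S` is a Diophantine `D(k)`-`N`-set: it consists of exactly `N` positive integers, and the
product of any two distinct elements, increased by `k`, is a perfect square. -/
def IsDiophantineSet (k : ℤ) (N : ℕ) (S : Finset ℕ) : Prop :=
  S.card = N ∧ (∀ a ∈ S, 0 < a) ∧
    ∀ a ∈ S, ∀ b ∈ S, a ≠ b → IsSquare ((a : ℤ) * (b : ℤ) + k)

/-- The sequence `v_p = (s/2) ((s + √c)^(2p) + (s - √c)^(2p))`. -/
noncomputable def vSeq (c s : ℕ) (p : ℕ) : ℝ :=
  (s : ℝ) / 2 * (((s : ℝ) + √(c : ℝ)) ^ (2 * p) + ((s : ℝ) - √(c : ℝ)) ^ (2 * p))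

/-- The sequence
`w_p = (s√b + ρr√c)/(2√b) (t + √(bc))^(2p) + (s√b - ρr√c)/(2√b) (t - √(bc))^(2p)`. -/
noncomputable def wSeq (b c r s t : ℕ) (ρ : ℤ) (p : ℕ) : ℝ :=
  ((s : ℝ) * √(b : ℝ) + (ρ : ℝ) * (r : ℝ) * √(c : ℝ)) / (2 * √(b : ℝ)) *
      ((t : ℝ) + √((b : ℝ) * (c : ℝ))) ^ (2 * p) +
    ((s : ℝ) * √(b : ℝ) - (ρ : ℝ) * (r : ℝ) * √(c : ℝ)) / (2 * √(b : ℝ)) *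
      ((t : ℝ) - √((b : ℝ) * (c : ℝ))) ^ (2 * p)

/-! Both sequences satisfy second-order integer recurrences. Suppose v_m = w_n with n small. Growth
gives m < 2n. Modulo 2c² the recurrences reduce to (-1)^p times a quadratic in p
(`pellRec_mul_modEq`), so c divides E = 2bn² - 2m² + ρn(b + F), where F = (t - rs)². Since (t -
rs)(t + rs) = b + c - 2, F is close to c/(4b). If n ≤ b and 64bn² ≤ c, then |E| < c, hence E = 0.
But F ≥ c/(4b) makes nF too large for the other terms to cancel, given also 8b²n ≤ c. Failure of
either claimed bound implies all three inequalities. -/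

/-- The integer solution of `x (p + 2) = (4 a - 2) x (p + 1) - x p` with initial values
`x₀` and `x₁`. -/
def pellRec (a x₀ x₁ : ℤ) : ℕ → ℤ
  | 0 => x₀
  | 1 => x₁
  | p + 2 => (4 * a - 2) * pellRec a x₀ x₁ (p + 1) - pellRec a x₀ x₁ p

theorem pellRec_add_two (a x₀ x₁ : ℤ) (p : ℕ) :
    pellRec a x₀ x₁ (p + 2) = (4 * a - 2) * pellRec a x₀ x₁ (p + 1) - pellRec a x₀ x₁ p := rfl

theorem eq_pellRec_of_recurrence {u : ℕ → ℝ} {a x₀ x₁ : ℤ} (h₀ : u 0 = x₀) (h₁ : u 1 = x₁)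
    (h : ∀ p, u (p + 2) = (4 * a - 2) * u (p + 1) - u p) (p : ℕ) :
    u p = pellRec a x₀ x₁ p := by
  induction p using Nat.twoStepInduction with
  | zero => exact h₀
  | one => exact h₁
  | more p ih₁ ih₂ =>
    rw [h, ih₁, ih₂, pellRec_add_two]
    push_cast
    ring

/-- Powers of `x ^ 2` satisfy the recurrence when `x ^ 2` is a root of
`X ^ 2 - (4 a - 2) X + 1`. -/
theorem pow_two_mul_recurrence {x a : ℝ} (hx : x ^ 4 = (4 * a - 2) * x ^ 2 - 1) (p : ℕ) :
    x ^ (2 * (p + 2)) = (4 * a - 2) * x ^ (2 * (p + 1)) - x ^ (2 * p) := by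
  have : x ^ (2 * (p + 2)) = x ^ (2 * p) * x ^ 4 := by ring
  rw [this, hx]
  ring

/-- The squares of u + q and u - q have sum 2u² + 2q² = 4a - 2 and product 1. -/
theorem pow_four_of_sq_eq {u q a : ℝ} (hu : a = u ^ 2 + 1) (hq : q ^ 2 = a) :
    (u + q) ^ 4 = (4 * a - 2) * (u + q) ^ 2 - 1 := by
  have h : q ^ 2 = u ^ 2 + 1 := hq.trans hu
  rw [hu]
  linear_combination (q ^ 2 + 4 * u * q + 3 * u ^ 2 - 1) * h

theorem vSeq_eq_pellRec {c s : ℕ} (hs : c = s ^ 2 + 1) (p : ℕ) :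
    vSeq c s p = pellRec c s (s * (2 * c - 1)) p := by
  have hsR : (c : ℝ) = (s : ℝ) ^ 2 + 1 := by exact_mod_cast hs
  have hq : √(c : ℝ) ^ 2 = c := Real.sq_sqrt (Nat.cast_nonneg c)
  have hq' : (-√(c : ℝ)) ^ 2 = c := by rw [neg_sq, hq]
  refine eq_pellRec_of_recurrence ?_ ?_ (fun k => ?_) p
  · simp only [vSeq, mul_zero, pow_zero]
    push_cast
    ring
  · simp only [vSeq]
    push_cast
    linear_combination (s : ℝ) * hq - (s : ℝ) * hsR
  · have h₁ := pow_two_mul_recurrence (pow_four_of_sq_eq hsR hq) k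
    have h₂ := pow_two_mul_recurrence (pow_four_of_sq_eq hsR hq') k
    simp only [← sub_eq_add_neg] at h₂
    simp only [vSeq, h₁, h₂, Int.cast_natCast]
    ring

theorem wSeq_eq_pellRec {b c r s t : ℕ} {ρ : ℤ} (hb : 0 < b) (ht : b * c = t ^ 2 + 1) (p : ℕ) :
    wSeq b c r s t ρ p = pellRec (b * c) s (s * (2 * (b * c) - 1) + 2 * ρ * r * c * t) p := by
  have htR : (b : ℝ) * c = (t : ℝ) ^ 2 + 1 := by exact_mod_cast ht
  have hq : √((b : ℝ) * c) ^ 2 = b * c := Real.sq_sqrt (by positivity)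
  have hq' : (-√((b : ℝ) * c)) ^ 2 = b * c := by rw [neg_sq, hq]
  have hb0 : √(b : ℝ) ≠ 0 := by positivity
  have hc2 : √(c : ℝ) ^ 2 = c := Real.sq_sqrt (Nat.cast_nonneg c)
  have hmul : √((b : ℝ) * c) = √(b : ℝ) * √(c : ℝ) := Real.sqrt_mul (Nat.cast_nonneg b) _
  refine eq_pellRec_of_recurrence ?_ ?_ (fun k => ?_) p
  · simp only [wSeq, mul_zero, pow_zero, mul_one]
    push_cast
    field_simp
    ring
  · have hb2 : √(b : ℝ) ^ 2 = b := Real.sq_sqrt (Nat.cast_nonneg b)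
    have key : wSeq b c r s t ρ 1 = s * ((t : ℝ) ^ 2 + √((b : ℝ) * c) ^ 2)
        + 2 * ρ * r * t * √(c : ℝ) ^ 2 := by
      simp only [wSeq, hmul]
      field_simp
      ring
    rw [key, hq, hc2]
    push_cast
    linear_combination (-(s : ℝ)) * htR
  · have h₁ := pow_two_mul_recurrence (pow_four_of_sq_eq htR hq) k
    have h₂ := pow_two_mul_recurrence (pow_four_of_sq_eq htR hq') k
    simp only [← sub_eq_add_neg] at h₂
    simp only [wSeq, h₁, h₂, Int.cast_mul, Int.cast_natCast]
    ring

/-- Modulo c the characteristic polynomial is (X + 1)²; the double root -1 makes the order-c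
correction quadratic in p. -/
theorem pellRec_mul_modEq (c e x₀ y : ℤ) (p : ℕ) :
    2 * c ^ 2 ∣ pellRec (e * c) x₀ (x₀ * (2 * (e * c) - 1) + 2 * c * y) p -
      (-1) ^ p * (x₀ - 2 * c * (e * x₀ * p ^ 2 + y * p)) := by
  induction p using Nat.twoStepInduction with
  | zero => simp [pellRec]
  | one =>
    refine ⟨0, ?_⟩
    simp only [pellRec]
    push_cast
    ring
  | more p ih₁ ih₂ =>
    obtain ⟨k₁, h₁⟩ := ih₁
    obtain ⟨k₂, h₂⟩ := ih₂
    rw [pellRec_add_two]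
    -- The last summand is 4ec times the order-c correction, a multiple of 2c².
    refine ⟨(4 * (e * c) - 2) * k₂ - k₁ +
      (-1) ^ p * (4 * e * (e * x₀ * (p + 1) ^ 2 + y * (p + 1))), ?_⟩
    push_cast at h₂ ⊢
    linear_combination (4 * (e * c) - 2) * h₂ - h₁

/-! ### Growth of the sequences -/

theorem mul_pow_le_pellRec {a x₀ : ℤ} (ha : 1 ≤ a) (hx : 0 ≤ x₀) (p : ℕ) :
    x₀ * (2 * a - 1) ^ p ≤ pellRec a x₀ (x₀ * (2 * a - 1)) p := by
  set v := pellRec a x₀ (x₀ * (2 * a - 1)) with hv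
  have step : ∀ p, 0 ≤ v p ∧ (2 * a - 1) * v p ≤ v (p + 1) := by
    intro p
    induction p with
    | zero => exact ⟨hx, by simp [hv, pellRec, mul_comm]⟩
    | succ p ih =>
      obtain ⟨h₀, h₁⟩ := ih
      have h₂ : v p ≤ v (p + 1) := by nlinarith
      have h₃ : 0 ≤ v (p + 1) := h₀.trans h₂
      refine ⟨h₃, ?_⟩
      have h₄ : v (p + 2) = (4 * a - 2) * v (p + 1) - v p := rfl
      rw [h₄]
      nlinarith
  induction p with
  | zero => simp [hv, pellRec]
  | succ p ih =>
    calc x₀ * (2 * a - 1) ^ (p + 1) = (2 * a - 1) * (x₀ * (2 * a - 1) ^ p) := by ring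
      _ ≤ (2 * a - 1) * v p := by gcongr; linarith
      _ ≤ v (p + 1) := (step p).2

theorem pellRec_le_mul_pow {a x₀ x₁ : ℤ} (ha : 1 ≤ a) (hx : 0 ≤ x₀) (h₁ : x₀ ≤ x₁)
    (h₂ : x₁ ≤ 4 * a * x₀) (p : ℕ) : pellRec a x₀ x₁ p ≤ x₀ * (4 * a) ^ p := by
  set w := pellRec a x₀ x₁ with hw
  have step : ∀ p, 0 ≤ w p ∧ w p ≤ w (p + 1) ∧ w (p + 1) ≤ 4 * a * w p := by
    intro p
    induction p with
    | zero => exact ⟨hx, h₁, h₂⟩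
    | succ p ih =>
      obtain ⟨i₀, i₁, -⟩ := ih
      have h₄ : w (p + 2) = (4 * a - 2) * w (p + 1) - w p := rfl
      refine ⟨i₀.trans i₁, ?_, ?_⟩ <;> rw [h₄] <;> nlinarith
  induction p with
  | zero => simp [hw, pellRec]
  | succ p ih =>
    calc w (p + 1) ≤ 4 * a * w p := (step p).2.2
      _ ≤ 4 * a * (x₀ * (4 * a) ^ p) := by gcongr
      _ = x₀ * (4 * a) ^ (p + 1) := by ring

/-! ### Consequences of v_m = w_n -/

section Equation

variable {b c r s t ρ : ℤ}

theorem le_initial_wSeq (hr0 : 0 ≤ r) (hs0 : 0 ≤ s) (ht0 : 0 ≤ t) (hb : 1 < b) (hbc : b < c)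
    (hr : b = r ^ 2 + 1) (hs : c = s ^ 2 + 1) (ht : b * c = t ^ 2 + 1) (hρ : ρ = 1 ∨ ρ = -1) :
    s ≤ s * (2 * (b * c) - 1) + 2 * c * (ρ * r * t) ∧
      s * (2 * (b * c) - 1) + 2 * c * (ρ * r * t) ≤ 4 * (b * c) * s := by
  have h₁ : r * c ≤ s * t := by
    refine abs_le_of_sq_le_sq' ?_ (by positivity) |>.2
    have e₁ : (r * c) ^ 2 = (b - 1) * c ^ 2 := by rw [hr]; ring
    have e₂ : (s * t) ^ 2 = (c - 1) * (b * c - 1) := by rw [ht]; nth_rw 1 [hs]; ring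
    rw [e₁, e₂]
    nlinarith
  have h₂ : r * t ≤ s * b := by
    refine abs_le_of_sq_le_sq' ?_ (by nlinarith) |>.2
    have e₁ : (r * t) ^ 2 = (b - 1) * (b * c - 1) := by rw [ht]; nth_rw 1 [hr]; ring
    have e₂ : (s * b) ^ 2 = (c - 1) * b ^ 2 := by rw [hs]; ring
    rw [e₁, e₂]
    nlinarith
  have h₃ : r * c * t ≤ s * (b * c - 1) := by
    have := mul_le_mul_of_nonneg_right h₁ ht0
    rw [ht]
    linarith
  have h₄ : r * t * c ≤ s * b * c := mul_le_mul_of_nonneg_right h₂ (by linarith)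
  have h₅ : 0 ≤ r * t * c := by have : 0 ≤ c := by linarith
                                positivity
  rcases hρ with rfl | rfl <;> constructor <;> nlinarith

theorem index_lt_two_mul (hr0 : 0 ≤ r) (hs0 : 0 < s) (ht0 : 0 ≤ t) (hb : 1 < b) (hbc : b < c)
    (hr : b = r ^ 2 + 1) (hs : c = s ^ 2 + 1) (ht : b * c = t ^ 2 + 1) (hρ : ρ = 1 ∨ ρ = -1)
    {m n : ℕ} (hn : n ≠ 0)
    (h : pellRec c s (s * (2 * c - 1)) m =
      pellRec (b * c) s (s * (2 * (b * c) - 1) + 2 * c * (ρ * r * t)) n) : m < 2 * n := by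
  by_contra! hm
  obtain ⟨h₁, h₂⟩ := le_initial_wSeq hr0 hs0.le ht0 hb hbc hr hs ht hρ
  have lo := mul_pow_le_pellRec (a := c) (x₀ := s) (by linarith) hs0.le m
  have hi := pellRec_le_mul_pow (a := b * c) (by nlinarith) hs0.le h₁ h₂ n
  -- As b ≤ c - 1, 4bc ≤ 4c² - 4c < (2c - 1)².
  have h₃ : (4 * (b * c)) ^ n < ((2 * c - 1) ^ 2) ^ n :=
    pow_lt_pow_left₀ (by nlinarith) (by nlinarith) hn
  have h₄ : ((2 * c - 1) ^ 2) ^ n ≤ (2 * c - 1) ^ m := by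
    rw [← pow_mul]
    exact pow_le_pow_right₀ (by linarith) hm
  have h₅ := mul_lt_mul_of_pos_left (h₃.trans_le h₄) hs0
  linarith

/-- The congruence between the two indices, in which `r s t` has been eliminated by means of
`t - r s`. -/
theorem dvd_of_pellRec_eq (hs0 : 0 < s) (hc : 1 < c)
    (hr : b = r ^ 2 + 1) (hs : c = s ^ 2 + 1) (ht : b * c = t ^ 2 + 1) {m n : ℕ}
    (h : pellRec c s (s * (2 * c - 1)) m =
      pellRec (b * c) s (s * (2 * (b * c) - 1) + 2 * c * (ρ * r * t)) n) :
    c ∣ 2 * b * n ^ 2 - 2 * m ^ 2 + ρ * n * (b + (t - r * s) ^ 2) := by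
  have hV := pellRec_mul_modEq c 1 s 0 m
  have hW := pellRec_mul_modEq c b s (ρ * r * t) n
  simp only [one_mul, mul_zero, add_zero, zero_mul] at hV
  rw [← h] at hW
  obtain ⟨k, hk⟩ := dvd_sub hW hV
  have hsc : s < c := by nlinarith
  -- Opposite signs would force 2c ∣ 2s, impossible for 0 < s < c.
  have hpar : (-1 : ℤ) ^ m = (-1) ^ n := by
    have no : ∀ k' : ℤ, 2 * s ≠ 2 * c * k' := by
      intro k' hk'
      have : 0 < k' := by
        by_contra! hle
        nlinarith
      nlinarith
    rcases neg_one_pow_eq_or ℤ m with hm | hm <;> rcases neg_one_pow_eq_or ℤ n with hn | hn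
    · rw [hm, hn]
    · rw [hm, hn] at hk
      exact absurd (by linear_combination hk)
        (no (c * k + s * m ^ 2 + (b * s * n ^ 2 + ρ * r * t * n)))
    · rw [hm, hn] at hk
      exact absurd (by linear_combination -hk)
        (no (-(c * k) + s * m ^ 2 + (b * s * n ^ 2 + ρ * r * t * n)))
    · rw [hm, hn]
  obtain ⟨ε, hε, hm, hn⟩ : ∃ ε : ℤ, ε * ε = 1 ∧ (-1) ^ m = ε ∧ (-1) ^ n = ε :=
    ⟨(-1) ^ n, by rw [← mul_pow]; simp, hpar, rfl⟩
  rw [hm, hn] at hk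
  have hk' : b * s * n ^ 2 + ρ * r * t * n - s * m ^ 2 = c * (ε * k) := by
    have hc0 : (2 * c : ℤ) ≠ 0 := by linarith
    apply mul_left_cancel₀ hc0
    linear_combination ε * hk -
      2 * c * (b * s * n ^ 2 + ρ * r * t * n - s * m ^ 2) * hε
  -- Multiply by -2s: modulo c, s² ≡ -1 and 2rst ≡ -b - (t - rs)².
  refine ⟨2 * b * n ^ 2 - 2 * m ^ 2 + ρ * n * (2 * b - 1) - 2 * s * ε * k, ?_⟩
  linear_combination (-2 * s) * hk' + (2 * m ^ 2 - 2 * b * n ^ 2 - ρ * n * r ^ 2) * hs +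
    ρ * n * (1 - c) * hr - ρ * n * ht

/-- Square (t - rs)(t + rs) = b + c - 2 and use 2rs ≤ t + rs ≤ 2√(bc). -/
theorem four_mul_sq_sub_ge (hr0 : 0 ≤ r) (hs0 : 0 ≤ s) (ht0 : 0 ≤ t) (hb : 1 < b) (hbc : b < c)
    (hr : b = r ^ 2 + 1) (hs : c = s ^ 2 + 1) (ht : b * c = t ^ 2 + 1) :
    c ≤ 4 * b * (t - r * s) ^ 2 ∧
      4 * (t - r * s) ^ 2 * ((b - 1) * (c - 1)) ≤ (b + c - 2) ^ 2 := by
  have hrs : 0 ≤ r * s := by positivity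
  have e : (t - r * s) * (t + r * s) = b + c - 2 := by
    linear_combination s ^ 2 * hr + (b - 1) * hs - ht
  have e₂ : (r * s) ^ 2 = (b - 1) * (c - 1) := by rw [hr, hs]; ring
  have hlt : r * s ≤ t := by nlinarith
  have e' : (t - r * s) ^ 2 * (t + r * s) ^ 2 = (b + c - 2) ^ 2 := by rw [← e]; ring
  have q := sq_nonneg (t - r * s)
  constructor
  · have h₁ : (t + r * s) ^ 2 ≤ 4 * (b * c) := by nlinarith
    have h₂ := mul_le_mul_of_nonneg_left h₁ q
    have h₃ : c ^ 2 ≤ (b + c - 2) ^ 2 := by nlinarith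
    nlinarith
  · have h₁ : 4 * ((b - 1) * (c - 1)) ≤ (t + r * s) ^ 2 := by rw [← e₂]; nlinarith
    have h₂ := mul_le_mul_of_nonneg_left h₁ q
    linarith

theorem false_of_small_index (hr0 : 0 ≤ r) (hs0 : 0 < s) (ht0 : 0 ≤ t) (hb : 1 < b) (hbc : b < c)
    (hr : b = r ^ 2 + 1) (hs : c = s ^ 2 + 1) (ht : b * c = t ^ 2 + 1) (hρ : ρ = 1 ∨ ρ = -1)
    {m n : ℕ} (hn : n ≠ 0) (hnb : n ≤ b) (h8 : 8 * b ^ 2 * n ≤ c) (h64 : 64 * b * n ^ 2 ≤ c)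
    (h : pellRec c s (s * (2 * c - 1)) m =
      pellRec (b * c) s (s * (2 * (b * c) - 1) + 2 * c * (ρ * r * t)) n) : False := by
  have hm := index_lt_two_mul hr0 hs0 ht0 hb hbc hr hs ht hρ hn h
  have hdvd := dvd_of_pellRec_eq hs0 (hb.trans hbc) hr hs ht h
  obtain ⟨lo, hi⟩ := four_mul_sq_sub_ge hr0 hs0.le ht0 hb hbc hr hs ht
  set F := (t - r * s) ^ 2
  have hF : 0 ≤ F := sq_nonneg _
  have hmZ : (m : ℤ) < 2 * n := by exact_mod_cast hm
  have hm0 : (0 : ℤ) ≤ m := Int.natCast_nonneg m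
  have hn1 : (1 : ℤ) ≤ n := by exact_mod_cast Nat.one_le_iff_ne_zero.2 hn
  generalize (m : ℤ) = M at *
  generalize (n : ℤ) = N at *
  have hMN : M ^ 2 < 4 * N ^ 2 := by nlinarith
  have hNN : N ≤ N ^ 2 := by nlinarith
  have hc64 : 64 * b ≤ c := by nlinarith
  -- `b * F` is close to `c / 4 * (b / (b - 1))`.
  have hbF : 50 * (b * F) ≤ 27 * c := by
    have h₁ : 64 * (b + c - 2) ≤ 65 * (c - 1) := by linarith
    have h₂ : (64 * (b + c - 2)) ^ 2 ≤ (65 * (c - 1)) ^ 2 :=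
      pow_le_pow_left₀ (by linarith) h₁ 2
    have h₃ : 16384 * (F * (b - 1)) ≤ 4225 * (c - 1) := by
      have hc1 : 0 < c - 1 := by linarith
      refine le_of_mul_le_mul_right ?_ hc1
      linarith
    -- Since b ≤ 2(b - 1), bF ≤ 2 · (4225/16384) c < 27c/50.
    have h₄ : 0 ≤ F * (b - 2) := mul_nonneg hF (by linarith)
    linarith
  have hNF : N * F ≤ b * F := mul_le_mul_of_nonneg_right hnb hF
  have hNb : 16 * (N * b) ≤ c := by
    have : 0 ≤ N * b * (b - 2) := mul_nonneg (mul_nonneg (by linarith) (by linarith)) (by linarith)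
    linarith
  have hN2 : 0 ≤ N ^ 2 := sq_nonneg N
  have h16 : 128 * N ^ 2 ≤ c := by
    have : 0 ≤ N ^ 2 * (b - 2) := mul_nonneg hN2 (by linarith)
    linarith
  have hNF0 : 0 ≤ N * F := mul_nonneg (by linarith) hF
  have hNb0 : 0 < N * b := mul_pos (by linarith) (by linarith)
  have hM0 : 0 ≤ M ^ 2 := sq_nonneg M
  have hbN : 0 ≤ b * N ^ 2 := mul_nonneg (by linarith) hN2
  -- The terms are small: 2bN² ≤ c/32, 2M² < c/16, Nb ≤ c/16, NF ≤ 27c/50.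
  have hzero : 2 * b * N ^ 2 - 2 * M ^ 2 + ρ * N * (b + F) = 0 := by
    refine Int.eq_zero_of_abs_lt_dvd hdvd (abs_lt.2 ?_)
    rcases hρ with rfl | rfl <;> constructor <;> linarith
  have hbig := mul_le_mul_of_nonneg_left lo (by linarith : 0 ≤ N)
  have hup := mul_le_mul_of_nonneg_left h8 (by linarith : 0 ≤ N)
  -- For ρ = 1, c ≤ 4bF < 32bN contradicts 64bN² ≤ c; for ρ = -1, c ≤ 4bF < 8b²N contradicts 8b²N ≤
  -- c.
  rcases hρ with rfl | rfl
  · have h₂ : N * F < 8 * N ^ 2 := by linarith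
    have h₃ := mul_lt_mul_of_pos_left h₂ (by linarith : 0 < b)
    have h₄ : 0 ≤ (N - 1) * c := mul_nonneg (by linarith) (by linarith)
    linarith
  · have h₂ : N * F < 2 * b * N ^ 2 := by linarith
    have h₃ := mul_lt_mul_of_pos_left h₂ (by linarith : 0 < b)
    linarith

end Equation

/-! ### From the real bounds to the integer inequalities -/

theorem index_bounds_of_le {b c n : ℕ} (hb : 1 < b) (h₃ : b ^ 3 < c)
    (h : (n : ℝ) ≤ min (b : ℝ) (0.125 * √((c : ℝ) / (b : ℝ)))) :
    n ≤ b ∧ 8 * b ^ 2 * n ≤ c ∧ 64 * b * n ^ 2 ≤ c := by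
  have hb0 : (0 : ℝ) < b := by positivity
  have h64 : 64 * b * n ^ 2 ≤ c := by
    have h₁ := h.trans (min_le_right _ _)
    have h₂ : (n : ℝ) ^ 2 ≤ (0.125 * √((c : ℝ) / b)) ^ 2 := by gcongr
    rw [mul_pow, Real.sq_sqrt (by positivity)] at h₂
    have h₄ : (64 * b * n ^ 2 : ℝ) ≤ 64 * b * (0.125 ^ 2 * (c / b)) := by gcongr
    have h₅ : (64 * b * (0.125 ^ 2 * (c / b)) : ℝ) = c := by field_simp; norm_num
    rw [h₅] at h₄
    exact_mod_cast h₄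
  refine ⟨by exact_mod_cast h.trans (min_le_left _ _), ?_, h64⟩
  refine (Nat.pow_le_pow_iff_left two_ne_zero).1 ?_
  calc (8 * b ^ 2 * n) ^ 2 = b ^ 3 * (64 * b * n ^ 2) := by ring
    _ ≤ c * c := Nat.mul_le_mul h₃.le h64
    _ = c ^ 2 := by ring

theorem index_bounds_of_le' {b c n : ℕ} (hb : 1 < b) (h₃ : c < b ^ 3)
    (h : (n : ℝ) ≤ 0.125 * ((c : ℝ) / (b : ℝ) ^ 2)) :
    n ≤ b ∧ 8 * b ^ 2 * n ≤ c ∧ 64 * b * n ^ 2 ≤ c := by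
  have hb0 : (0 : ℝ) < b := by positivity
  have h8 : 8 * b ^ 2 * n ≤ c := by
    have h₄ : (8 * b ^ 2 * n : ℝ) ≤ 8 * b ^ 2 * (0.125 * (c / b ^ 2)) := by gcongr
    have h₅ : (8 * b ^ 2 * (0.125 * (c / b ^ 2)) : ℝ) = c := by field_simp; norm_num
    rw [h₅] at h₄
    exact_mod_cast h₄
  have hnb : 8 * n ≤ b := by
    have : b ^ 2 * (8 * n) ≤ b ^ 2 * b := by nlinarith
    exact Nat.le_of_mul_le_mul_left this (by positivity)
  refine ⟨by omega, h8, ?_⟩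
  calc 64 * b * n ^ 2 = 8 * b * n * (8 * n) := by ring
    _ ≤ 8 * b * n * b := Nat.mul_le_mul_left _ hnb
    _ = 8 * b ^ 2 * n := by ring
    _ ≤ c := h8

theorem mainTheorem11
    (b c d : ℕ) (hb : 1 < b) (hbc : b < c) (hcd : c < d)
    (hquad : IsDiophantineSet (-1) 4 {1, b, c, d})
    (r s t z : ℕ)
    (hr : b = r ^ 2 + 1) (hs : c = s ^ 2 + 1) (ht : b * c = t ^ 2 + 1)
    (hz : c * d = z ^ 2 + 1)
    (ρ : ℤ) (hρ : ρ = 1 ∨ ρ = -1)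
    (m n : ℕ) (hv : (z : ℝ) = vSeq c s m) (hw : (z : ℝ) = wSeq b c r s t ρ n) :
    (b ^ 3 < c → min (b : ℝ) (0.125 * √((c : ℝ) / (b : ℝ))) < (n : ℝ)) ∧
    (4 * b ^ 2 < c → c < b ^ 3 → 0.125 * ((c : ℝ) / (b : ℝ) ^ 2) < (n : ℝ)) := by
  rw [vSeq_eq_pellRec hs] at hv
  rw [wSeq_eq_pellRec (by omega) ht] at hw
  have hn : n ≠ 0 := by
    rintro rfl
    have hzs : z = s := by simpa [pellRec] using hw
    rw [hzs, ← hs] at hz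
    nlinarith
  have h : pellRec c s (s * (2 * c - 1)) m =
      pellRec (b * c) s (s * (2 * (b * c) - 1) + 2 * c * (ρ * r * t)) n := by
    have : (2 * c * (ρ * r * t) : ℤ) = 2 * ρ * r * c * t := by ring
    rw [this]
    exact_mod_cast hv.symm.trans hw
  have hs0 : 0 < s := by
    rcases Nat.eq_zero_or_pos s with rfl | h0
    · omega
    · exact h0
  have key : ¬ (n ≤ b ∧ 8 * b ^ 2 * n ≤ c ∧ 64 * b * n ^ 2 ≤ c) := fun ⟨hnb, h8, h64⟩ =>
    false_of_small_index (b := b) (c := c) (r := r) (s := s) (t := t) (ρ := ρ) (m := m) (n := n)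
      (Int.natCast_nonneg r) (by exact_mod_cast hs0) (Int.natCast_nonneg t) (by exact_mod_cast hb)
      (by exact_mod_cast hbc) (by exact_mod_cast hr) (by exact_mod_cast hs) (by exact_mod_cast ht)
      hρ hn (by exact_mod_cast hnb) (by exact_mod_cast h8) (by exact_mod_cast h64) h
  refine ⟨fun h₃ => ?_, fun _ h₃ => ?_⟩ <;> by_contra! hle
  · exact key (index_bounds_of_le hb h₃ hle)
  · exact key (index_bounds_of_le' hb h₃ hle)
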